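/- For a finite graph $G$, let $\tau(G)$ be the maximum number of colors in an edge-coloring of $G$ (not necessarily proper, every color being used) in which no two color classes are isomorphic as graphs. Let $G(n,p)$ be the binomial (Erdős–Rényi) random graph on $n$ labelled vertices, in which each pair of vertices is an edge independently with probability $p$. There are absolute constants $C, c_1, c_2 > 0$ such that for every sequence $p = p(n) \in [0,1]$ with $p(n) \ge C/n$ for all sufficiently large $n$, $$\Pr\left( c_1\,\frac{p n^2}{\log^2 n} \;\le\; \tau(G(n,p)) \;\le\; c_2\,\frac{p n^2 \log\log n}{\log n} \right) \longrightarrow 1 \qquad (n \to \infty).$$ -/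

import Mathlib

namespace SimpleGraph

variable {V : Type*}

/-- An edge-coloring of `G` in which no two color classes are isomorphic. The class of a color is
taken as a spanning subgraph; as all classes live on the same vertex set, for finite `V` two classes
are isomorphic as spanning subgraphs if and only if they are after deleting isolated vertices. -/
def EdgeLabeling.PairwiseNonIsomorphic {G : SimpleGraph V} {K : Type*} (c : G.EdgeLabeling K) :
    Prop :=
  Pairwise fun i j => IsEmpty (c.labelGraph i ≃g c.labelGraph j)

/-- The numbers `k` such that `G` has an edge-coloring that uses exactly `k` colors and in which no
two color classes are isomorphic. -/
def nonIsomorphicColorCounts (G : SimpleGraph V) : Set ℕ :=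
  {k | ∃ c : G.EdgeLabeling (Fin k), Function.Surjective c ∧ c.PairwiseNonIsomorphic}

/-- `τ(G)`: the maximum number of colors in an edge-coloring of `G` with no two color classes
isomorphic. -/
noncomputable def tau (G : SimpleGraph V) : ℕ :=
  sSup G.nonIsomorphicColorCounts

/-- On a finite vertex set the maximum in the definition of `τ(G)` is attained. -/
theorem isGreatest_tau [Finite V] (G : SimpleGraph V) :
    IsGreatest G.nonIsomorphicColorCounts G.tau := by
  have hb : BddAbove G.nonIsomorphicColorCounts := by
    refine ⟨Nat.card G.edgeSet, ?_⟩
    rintro k ⟨c, hc, -⟩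
    simpa using Nat.card_le_card_of_surjective c hc
  have hne : G.nonIsomorphicColorCounts.Nonempty := by
    rcases isEmpty_or_nonempty G.edgeSet with h | ⟨⟨e⟩⟩
    · exact ⟨0, fun e => (h.false e).elim, fun i => i.elim0, fun i => i.elim0⟩
    · exact ⟨1, fun _ => 0, fun i => ⟨e, Subsingleton.elim _ _⟩,
        fun i j hij => (hij (Subsingleton.elim i j)).elim⟩
  exact ⟨Nat.sSup_mem hne hb, fun _ hk => le_csSup hb hk⟩

end SimpleGraph

/-! Upper bound. With exponentially small failure probability there are at most `2 * p * n ^ 2`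
edges. Take `k` about `log n / (6 * log (log n))`. At most `(2 * k + 1) ^ (2 * k + 1) ≤ √n`
isomorphism types have at most `k` edges, so all but `√n` color classes have more than `k` edges,
and these number at most `2 * p * n ^ 2 / (k + 1)` (`mul_tau_le`). The term `√n` is negligible
because `p * n ^ 2 ≥ n`.

Lower bound. With high probability any two disjoint sets of `n / 4 + 1` vertices are joined by at
least `p * n ^ 2 / 64` edges. As long as fewer edges have been deleted, depth-first search finds a
path on `(d + 1) ^ 2` vertices, where `d` is about `2 * log₂ n`. Cut it into blocks of `1, 3, 5, …,
2 * d + 1` vertices and keep only the blocks indexed by a set `S ⊆ {1, …, d}`: the component sizes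
of the resulting linear forest reveal `S`. There are more than enough sets `S`, and each forest
costs `O(log² n)` edges, so order `p * n ^ 2 / log² n` of them can be removed greedily
(`le_tau_of_crossPairs`). Unused edges join the largest class.

Both random estimates come from one exponential moment bound, `binomialRandom_real_le`. -/

namespace SimpleGraph

variable {V : Type*}

/-! ### Colorings from disjoint subgraphs -/

theorem EdgeLabeling.edgeSet_labelGraph {G : SimpleGraph V} {K : Type*} (c : G.EdgeLabeling K)
    (i : K) : (c.labelGraph i).edgeSet = Subtype.val '' {e : G.edgeSet | c e = i} := by
  ext e
  induction e using Sym2.ind with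
  | _ x y => simp [EdgeLabeling.labelGraph_adj]

theorem Iso.ncard_edgeSet_eq {W : Type*} {G : SimpleGraph V} {H : SimpleGraph W} (f : G ≃g H) :
    G.edgeSet.ncard = H.edgeSet.ncard := by
  rw [← Nat.card_coe_set_eq, ← Nat.card_coe_set_eq]
  exact Nat.card_congr f.mapEdgeSet

/-- Edges outside the given subgraphs can be added to one with the most edges. -/
theorem le_tau_of_pairwise_disjoint [Finite V] {G : SimpleGraph V} {N : ℕ}
    (H : Fin N → SimpleGraph V) (hle : ∀ i, H i ≤ G) (hne : ∀ i, H i ≠ ⊥)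
    (hdisj : ∀ i j, i ≠ j → Disjoint (H i) (H j))
    (hiso : ∀ i j, i ≠ j → IsEmpty (H i ≃g H j)) : N ≤ G.tau := by
  classical
  rcases Nat.eq_zero_or_pos N with rfl | hN
  · exact Nat.zero_le _
  have : Nonempty (Fin N) := ⟨⟨0, hN⟩⟩
  obtain ⟨m, hm⟩ := Finite.exists_max fun i => (H i).edgeSet.ncard
  let c : G.EdgeLabeling (Fin N) := fun e =>
    if h : ∃ i, (e : Sym2 V) ∈ (H i).edgeSet then h.choose else m
  have huniq : ∀ e i j, e ∈ (H i).edgeSet → e ∈ (H j).edgeSet → i = j := by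
    intro e i j hi hj
    by_contra hij
    exact Set.disjoint_left.1 (disjoint_edgeSet.2 (hdisj i j hij)) hi hj
  have hc : ∀ (e : G.edgeSet) i, (e : Sym2 V) ∈ (H i).edgeSet → c e = i := by
    intro e i hi
    have h : ∃ i, (e : Sym2 V) ∈ (H i).edgeSet := ⟨i, hi⟩
    simp only [c, dif_pos h]
    exact huniq _ _ _ h.choose_spec hi
  have hsub : ∀ i, H i ≤ c.labelGraph i := by
    intro i
    rw [← edgeSet_subset_edgeSet, c.edgeSet_labelGraph]
    intro e he
    exact ⟨⟨e, edgeSet_subset_edgeSet.2 (hle i) he⟩, hc _ _ he, rfl⟩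
  have heq : ∀ i, i ≠ m → c.labelGraph i = H i := by
    intro i hi
    refine le_antisymm ?_ (hsub i)
    rw [← edgeSet_subset_edgeSet, c.edgeSet_labelGraph]
    rintro _ ⟨e, he, rfl⟩
    by_cases h : ∃ j, (e : Sym2 V) ∈ (H j).edgeSet
    · obtain ⟨j, hj⟩ := h
      rw [← show c e = i from he, hc e j hj]
      exact hj
    · exact absurd (by simpa only [c, dif_neg h] using he.symm) hi
  have hmax : ∀ j, j ≠ m → IsEmpty (c.labelGraph m ≃g H j) := by
    intro j hj
    refine ⟨fun f => ?_⟩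
    -- An isomorphism gives the enlarged class no more edges than the maximal `H m`; hence nothing
    -- was added to it, and `hiso` applies.
    have h : H m = c.labelGraph m := by
      rw [← edgeSet_inj]
      exact Set.eq_of_subset_of_ncard_le (edgeSet_subset_edgeSet.2 (hsub m))
        (f.ncard_edgeSet_eq.le.trans (hm j))
    rw [← h] at f
    exact (hiso m j hj.symm).false f
  refine (isGreatest_tau G).2 ⟨c, fun i => ?_, fun i j hij => ?_⟩
  · obtain ⟨e, he⟩ := edgeSet_nonempty.2 (hne i)
    exact ⟨⟨e, edgeSet_subset_edgeSet.2 (hle i) he⟩, hc _ _ he⟩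
  · change IsEmpty (c.labelGraph i ≃g c.labelGraph j)
    by_cases hi : i = m
    · subst hi
      rw [heq j hij.symm]
      exact hmax j hij.symm
    · rw [heq i hi]
      by_cases hj : j = m
      · subst hj
        exact ⟨fun f => (hmax i hi).false f.symm⟩
      · rw [heq j hj]
        exact hiso i j hij

/-! ### Linear forests cut from a path -/

/-- Cut a path `f 0, …, f (L - 1)` into the blocks on which `Nat.sqrt` is constant and keep the
edges of the blocks with index in `S`. -/
def blockGraph (f : ℕ → V) (L : ℕ) (S : Finset ℕ) : SimpleGraph V :=
  fromEdgeSet {e | ∃ x, x + 1 < L ∧ x.sqrt = (x + 1).sqrt ∧ x.sqrt ∈ S ∧ e = s(f x, f (x + 1))}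

theorem blockGraph_le {f : ℕ → V} {L : ℕ} {S : Finset ℕ} {G : SimpleGraph V}
    (h : ∀ x, x + 1 < L → G.Adj (f x) (f (x + 1))) : blockGraph f L S ≤ G := by
  rw [← edgeSet_subset_edgeSet]
  intro e he
  simp only [blockGraph, edgeSet_fromEdgeSet] at he
  obtain ⟨⟨x, hx, -, -, rfl⟩, -⟩ := he
  exact h x hx

theorem ncard_edgeSet_blockGraph_le (f : ℕ → V) (L : ℕ) (S : Finset ℕ) :
    (blockGraph f L S).edgeSet.ncard ≤ L := by
  classical
  have h : (blockGraph f L S).edgeSet ⊆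
      ((Finset.range L).image fun x => s(f x, f (x + 1)) : Finset (Sym2 V)) := by
    intro e he
    simp only [blockGraph, edgeSet_fromEdgeSet] at he
    obtain ⟨⟨x, hx, -, -, rfl⟩, -⟩ := he
    simp only [Finset.coe_image, Set.mem_image, Finset.coe_range, Set.mem_Iio]
    exact ⟨x, by lia, rfl⟩
  calc _ ≤ _ := Set.ncard_le_ncard h (Finset.finite_toSet _)
    _ ≤ L := by
      rw [Set.ncard_coe_finset]
      exact Finset.card_image_le.trans (by simp)

theorem blockGraph_adj_succ {f : ℕ → V} {L : ℕ} {S : Finset ℕ} (hf : Set.InjOn f (Set.Iio L))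
    {x : ℕ} (hx : x + 1 < L) (hs : x.sqrt = (x + 1).sqrt) (hS : x.sqrt ∈ S) :
    (blockGraph f L S).Adj (f x) (f (x + 1)) := by
  refine (fromEdgeSet_adj _).2 ⟨⟨x, hx, hs, hS, rfl⟩, fun h => ?_⟩
  have := hf (show x < L by lia) (show x + 1 < L from hx) h
  lia

theorem exists_of_blockGraph_adj {f : ℕ → V} {L : ℕ} {S : Finset ℕ} {u v : V}
    (h : (blockGraph f L S).Adj u v) :
    ∃ x y, x < L ∧ y < L ∧ x.sqrt = y.sqrt ∧ x.sqrt ∈ S ∧ u = f x ∧ v = f y := by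
  obtain ⟨⟨x, hx, hs, hS, he⟩, -⟩ := (fromEdgeSet_adj _).1 h
  rcases Sym2.eq_iff.1 he with ⟨rfl, rfl⟩ | ⟨rfl, rfl⟩
  · exact ⟨x, x + 1, by lia, hx, hs, hS, rfl, rfl⟩
  · exact ⟨x + 1, x, hx, by lia, hs.symm, hs ▸ hS, rfl, rfl⟩

theorem blockGraph_reachable {f : ℕ → V} {L : ℕ} {S : Finset ℕ} (hf : Set.InjOn f (Set.Iio L))
    {x y : ℕ} (hxy : x ≤ y) (hy : y < L) (hs : x.sqrt = y.sqrt) (hS : x.sqrt ∈ S) :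
    (blockGraph f L S).Reachable (f x) (f y) := by
  induction y, hxy using Nat.le_induction with
  | base => exact Reachable.refl _
  | succ y hxy ih =>
    have h1 : x.sqrt = y.sqrt :=
      le_antisymm (Nat.sqrt_le_sqrt hxy) (hs ▸ Nat.sqrt_le_sqrt (Nat.le_succ y))
    exact (ih (by lia) h1).trans
      (blockGraph_adj_succ hf hy (h1.symm.trans hs) (h1 ▸ hS)).reachable

/-- Edges stay inside a block, and a kept block (truncated at `L`) is connected along the path. -/
theorem setOf_reachable_blockGraph {f : ℕ → V} {L : ℕ} {S : Finset ℕ}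
    (hf : Set.InjOn f (Set.Iio L)) {x : ℕ} (hx : x < L) (hS : x.sqrt ∈ S) :
    {w | (blockGraph f L S).Reachable (f x) w} = f '' {y | y < L ∧ y.sqrt = x.sqrt} := by
  ext w
  constructor
  · intro h
    rw [Set.mem_ofPred_eq, reachable_iff_reflTransGen] at h
    induction h with
    | refl => exact ⟨x, ⟨hx, rfl⟩, rfl⟩
    | tail _ h ih =>
      obtain ⟨y, ⟨hy, hys⟩, rfl⟩ := ih
      obtain ⟨a, b, ha, hb, hab, -, h1, rfl⟩ := exists_of_blockGraph_adj h
      obtain rfl := hf hy ha h1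
      exact ⟨b, ⟨hb, hab.symm.trans hys⟩, rfl⟩
  · rintro ⟨y, ⟨hy, hys⟩, rfl⟩
    rcases le_total x y with h | h
    · exact blockGraph_reachable hf h hy hys.symm hS
    · exact (blockGraph_reachable hf h hx hys (hys ▸ hS)).symm

/-- Block `i` is the interval from `i ^ 2` to `(i + 1) ^ 2 - 1`. Thus block sizes are distinct while
the total length is only quadratic in the number of blocks. -/
theorem ncard_image_sqrt_eq {f : ℕ → V} {L i : ℕ} (hf : Set.InjOn f (Set.Iio L))
    (hi : (i + 1) ^ 2 ≤ L) : (f '' {y | y < L ∧ y.sqrt = i}).ncard = 2 * i + 1 := by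
  rw [(hf.mono fun y hy => hy.1 : Set.InjOn f {y | y < L ∧ y.sqrt = i}).ncard_image]
  have : {y | y < L ∧ y.sqrt = i} = (Finset.Ico (i ^ 2) ((i + 1) ^ 2) : Finset ℕ) := by
    ext y
    simp only [Set.mem_ofPred_eq, Finset.coe_Ico, Set.mem_Ico, eq_comm (a := y.sqrt),
      Nat.eq_sqrt']
    lia
  rw [this, Set.ncard_coe_finset, Nat.card_Ico]
  grind

/-- The block indices can be read off from the sizes of the connected components. -/
theorem exists_ncard_reachable_blockGraph_iff {f : ℕ → V} {L : ℕ} {S : Finset ℕ}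
    (hf : Set.InjOn f (Set.Iio L)) (hS : ∀ i ∈ S, (i + 1) ^ 2 ≤ L) {i : ℕ} (hi : 1 ≤ i) :
    (∃ v, {w | (blockGraph f L S).Reachable v w}.ncard = 2 * i + 1) ↔ i ∈ S := by
  constructor
  · rintro ⟨v, hv⟩
    by_cases h : ∃ w, (blockGraph f L S).Adj v w
    · obtain ⟨w, hw⟩ := h
      obtain ⟨x, y, hx, -, -, hxS, rfl, -⟩ := exists_of_blockGraph_adj hw
      rw [setOf_reachable_blockGraph hf hx hxS, ncard_image_sqrt_eq hf (hS _ hxS)] at hv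
      rwa [show i = x.sqrt by lia]
    -- Vertices outside the kept blocks are components of size `1`, the size belonging to index `0`;
    -- hence the restriction to `1 ≤ i`.
    · have : {w | (blockGraph f L S).Reachable v w} = {v} := by
        ext w
        constructor
        · intro hw
          rw [Set.mem_ofPred_eq, reachable_iff_reflTransGen] at hw
          rcases hw.cases_head with rfl | ⟨u, hu, -⟩
          · rfl
          · exact absurd ⟨u, hu⟩ h
        · rintro rfl
          exact Reachable.refl _
      rw [this, Set.ncard_singleton] at hv
      lia
  · intro h
    have hs : (i ^ 2).sqrt = i := Nat.sqrt_eq' i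
    have hL := hS i h
    refine ⟨f (i ^ 2), ?_⟩
    rw [setOf_reachable_blockGraph hf (by nlinarith) (hs.symm ▸ h), hs, ncard_image_sqrt_eq hf hL]

theorem Iso.exists_ncard_reachable {W : Type*} {G : SimpleGraph V} {H : SimpleGraph W} (e : G ≃g H)
    {m : ℕ} (h : ∃ v, {w | G.Reachable v w}.ncard = m) : ∃ v, {w | H.Reachable v w}.ncard = m := by
  obtain ⟨v, rfl⟩ := h
  refine ⟨e v, ?_⟩
  rw [← Set.ncard_image_of_injective _ e.injective]
  congr 1
  ext w
  obtain ⟨u, rfl⟩ := e.surjective w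
  simp [e.reachable_iff]

theorem blockGraph_iso_eq {f g : ℕ → V} {L : ℕ} {S T : Finset ℕ} (hf : Set.InjOn f (Set.Iio L))
    (hg : Set.InjOn g (Set.Iio L)) (hS : ∀ i ∈ S, 1 ≤ i ∧ (i + 1) ^ 2 ≤ L)
    (hT : ∀ i ∈ T, 1 ≤ i ∧ (i + 1) ^ 2 ≤ L) (e : blockGraph f L S ≃g blockGraph g L T) :
    S = T := by
  have h1 := fun i (hi : 1 ≤ i) =>
    exists_ncard_reachable_blockGraph_iff hf (fun i hi => (hS i hi).2) hi
  have h2 := fun i (hi : 1 ≤ i) =>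
    exists_ncard_reachable_blockGraph_iff hg (fun i hi => (hT i hi).2) hi
  ext i
  constructor
  · intro hi
    exact (h2 i (hS i hi).1).1 (e.exists_ncard_reachable ((h1 i (hS i hi).1).2 hi))
  · intro hi
    exact (h1 i (hT i hi).1).1 (e.symm.exists_ncard_reachable ((h2 i (hT i hi).1).2 hi))

theorem blockGraph_ne_bot {f : ℕ → V} {L : ℕ} {S : Finset ℕ} (hf : Set.InjOn f (Set.Iio L))
    (hS : ∀ i ∈ S, 1 ≤ i ∧ (i + 1) ^ 2 ≤ L) (hne : S.Nonempty) : blockGraph f L S ≠ ⊥ := by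
  obtain ⟨i, hi⟩ := hne
  obtain ⟨h1, h2⟩ := hS i hi
  have hs : (i ^ 2).sqrt = i := Nat.sqrt_eq' i
  have hs' : (i ^ 2 + 1).sqrt = i := by
    rw [eq_comm, Nat.eq_sqrt']
    constructor <;> nlinarith
  intro h
  have := blockGraph_adj_succ (S := S) hf (x := i ^ 2) (by nlinarith) (hs.trans hs'.symm)
    (hs.symm ▸ hi)
  simp [h] at this

/-! ### Long paths by depth-first search -/

/-- Depth-first search: `A` is the set of finished vertices, `B` that of unvisited ones, and the
list is the current stack. -/
theorem exists_dfs_state [Fintype V] [DecidableEq V] (G : SimpleGraph V) (j : ℕ)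
    (hj : j ≤ Fintype.card V) :
    ∃ (A B : Finset V) (l : List V), Disjoint A B ∧ l.Nodup ∧ l.IsChain G.Adj ∧
      (∀ v, v ∈ l ↔ v ∉ A ∧ v ∉ B) ∧ (∀ a ∈ A, ∀ b ∈ B, ¬ G.Adj a b) ∧
      B.card + j = A.card + Fintype.card V := by
  -- `j` counts moves: a push takes a vertex out of `B`, a pop puts one into `A`, so `|A| - |B|`
  -- grows by one each time.
  induction j with
  | zero => exact ⟨∅, Finset.univ, [], by simp, by simp, by simp, by simp, by simp, by simp⟩
  | succ j ih =>
    obtain ⟨A, B, l, hAB, hl, hc, hmem, hno, hcard⟩ := ih (by lia)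
    have hB : B.Nonempty := by
      rw [← Finset.card_pos]
      lia
    have push : ∀ b ∈ B, (b :: l).IsChain G.Adj → ∃ (A B : Finset V) (l : List V),
        Disjoint A B ∧ l.Nodup ∧ l.IsChain G.Adj ∧
        (∀ v, v ∈ l ↔ v ∉ A ∧ v ∉ B) ∧ (∀ a ∈ A, ∀ b ∈ B, ¬ G.Adj a b) ∧
        B.card + (j + 1) = A.card + Fintype.card V := by
      intro b hb hch
      refine ⟨A, B.erase b, b :: l, hAB.mono_right (Finset.erase_subset _ _), ?_, hch, ?_, ?_, ?_⟩
      · exact List.nodup_cons.2 ⟨fun h => ((hmem b).1 h).2 hb, hl⟩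
      · intro v
        have := fun h : v ∈ A => Finset.disjoint_left.1 hAB h
        by_cases hv : v = b
        · subst hv
          simpa using fun h => this h hb
        · simp [hv, hmem]
      · exact fun a ha c hc => hno a ha c (Finset.mem_of_mem_erase hc)
      · have := Finset.card_erase_add_one hb
        lia
    cases l with
    | nil =>
      obtain ⟨b, hb⟩ := hB
      exact push b hb (by simp)
    | cons a l =>
      by_cases h : ∃ b ∈ B, G.Adj b a
      · obtain ⟨b, hb, hba⟩ := h
        exact push b hb (List.isChain_cons_cons.2 ⟨hba, hc⟩)
      · push Not at h
        have ha := (hmem a).1 (by simp)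
        obtain ⟨hal, hl'⟩ := List.nodup_cons.1 hl
        refine ⟨insert a A, B, l, ?_, hl', hc.of_cons, ?_, ?_, ?_⟩
        · exact Finset.disjoint_insert_left.2 ⟨ha.2, hAB⟩
        · intro v
          have := hmem v
          by_cases hv : v = a
          · subst hv
            simp [hal]
          · simpa [hv] using this
        · intro x hx b hb
          rcases Finset.mem_insert.1 hx with rfl | hx
          · exact fun hadj => h b hb hadj.symm
          · exact hno x hx b hb
        · rw [Finset.card_insert_of_notMem ha.1]
          lia

/-- If any two disjoint `k`-sets are joined by an edge, there is a path missing at most `2 * k`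
vertices. -/
theorem exists_injOn_adj_succ [Finite V] [Nonempty V] (G : SimpleGraph V) {k L : ℕ}
    (h : ∀ A B : Finset V, A.card = k → B.card = k → Disjoint A B → ∃ a ∈ A, ∃ b ∈ B, G.Adj a b)
    (hL : L + 2 * k ≤ Nat.card V) :
    ∃ f : ℕ → V, Set.InjOn f (Set.Iio L) ∧ ∀ x, x + 1 < L → G.Adj (f x) (f (x + 1)) := by
  classical
  cases nonempty_fintype V
  rw [Nat.card_eq_fintype_card] at hL
  -- After `Nat.card V` moves `A` and `B` have equal size. No edge joins them, so each has at most
  -- `k` vertices, and the stack is a path on all the others.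
  obtain ⟨A, B, l, hAB, hl, hc, hmem, hno, hcard⟩ := exists_dfs_state G _ le_rfl
  have hA : A.card ≤ k := by
    by_contra! hk
    obtain ⟨A', hA', hA'c⟩ := Finset.exists_subset_card_eq hk.le
    obtain ⟨B', hB', hB'c⟩ := Finset.exists_subset_card_eq (s := B) (n := k) (by lia)
    obtain ⟨a, ha, b, hb, hab⟩ := h A' B' hA'c hB'c
      (Finset.disjoint_of_subset_left hA' (Finset.disjoint_of_subset_right hB' hAB))
    exact hno a (hA' ha) b (hB' hb) hab
  have hlen : L ≤ l.length := by
    have h1 : l.toFinset = (A ∪ B)ᶜ := by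
      ext v
      simp [hmem]
    have h2 : l.length + (A ∪ B).card = Fintype.card V := by
      rw [← List.toFinset_card_of_nodup hl, h1, Finset.card_compl_add_card]
    rw [Finset.card_union_of_disjoint hAB] at h2
    lia
  refine ⟨fun x => l.getD x (Classical.arbitrary V), ?_, ?_⟩
  · intro x hx y hy hxy
    have hx' : x < l.length := lt_of_lt_of_le hx hlen
    have hy' : y < l.length := lt_of_lt_of_le hy hlen
    simp only [List.getD_eq_getElem _ _ hx', List.getD_eq_getElem _ _ hy'] at hxy
    exact (hl.getElem_inj_iff).1 hxy
  · intro x hx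
    have hx' : x + 1 < l.length := lt_of_lt_of_le hx hlen
    simp only [List.getD_eq_getElem _ _ hx', List.getD_eq_getElem _ _ (Nat.lt_of_succ_lt hx')]
    exact List.isChain_iff_getElem.1 hc x hx'

/-! ### Greedy packing of linear forests -/

/-- The pairs with one vertex in `A` and one in `B`. -/
def crossPairs [DecidableEq V] (A B : Finset V) : Finset (Sym2 V) :=
  (A ×ˢ B).image fun x => s(x.1, x.2)

/-- Block graphs are found and removed one after the other. -/
theorem exists_disjoint_blockGraphs [Finite V] [Nonempty V] [DecidableEq V] (G : SimpleGraph V)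
    {k L M : ℕ} (hG : ∀ A B : Finset V, A.card = k → B.card = k → Disjoint A B →
      M ≤ (G.edgeSet ∩ crossPairs A B).ncard)
    (hL : L + 2 * k ≤ Nat.card V) (S : ℕ → Finset ℕ) (N : ℕ) (hN : N * L < M + L) :
    ∃ f : ℕ → ℕ → V, (∀ i < N, Set.InjOn (f i) (Set.Iio L) ∧ blockGraph (f i) L (S i) ≤ G) ∧
      ∀ i < N, ∀ j < N, i ≠ j → Disjoint (blockGraph (f i) L (S i)) (blockGraph (f j) L (S j)) := by
  induction N with
  | zero => exact ⟨fun _ _ => Classical.arbitrary V, by simp, by simp⟩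
  | succ N ih =>
    -- Only the `N` earlier graphs, with at most `L` edges each, are deleted before the next path is
    -- sought; this is the slack `L` in `hN`.
    have hN' : N * L < M := by
      rw [Nat.succ_mul] at hN
      lia
    obtain ⟨f, hf, hdisj⟩ := ih (by lia)
    let R : Set (Sym2 V) := ⋃ i ∈ Finset.range N, (blockGraph (f i) L (S i)).edgeSet
    have hR : R.ncard ≤ N * L := by
      refine (Finset.set_ncard_biUnion_le _ _).trans ?_
      refine (Finset.sum_le_card_nsmul _ _ L fun i _ => ncard_edgeSet_blockGraph_le _ _ _).trans ?_
      simp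
    obtain ⟨g, hg, hadj⟩ := exists_injOn_adj_succ (G.deleteEdges R) (k := k) (L := L) (by
      intro A B hA hB hAB
      have h1 := hG A B hA hB hAB
      obtain ⟨e, ⟨heG, heC⟩, heR⟩ : ((G.edgeSet ∩ crossPairs A B) \ R).Nonempty := by
        by_contra hne
        rw [Set.not_nonempty_iff_eq_empty, Set.sdiff_eq_empty] at hne
        have := Set.ncard_le_ncard hne (Set.toFinite R)
        lia
      simp only [crossPairs, Finset.coe_image, Set.mem_image, Finset.mem_coe,
        Finset.mem_product] at heC
      obtain ⟨⟨a, b⟩, ⟨ha, hb⟩, rfl⟩ := heC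
      exact ⟨a, ha, b, hb, deleteEdges_adj.2 ⟨heG, heR⟩⟩) hL
    have hle : blockGraph g L (S N) ≤ G.deleteEdges R := blockGraph_le hadj
    have hnew : ∀ i < N, Disjoint (blockGraph (f i) L (S i)) (blockGraph g L (S N)) := by
      intro i hi
      rw [← disjoint_edgeSet, Set.disjoint_left]
      intro e he he'
      have := edgeSet_subset_edgeSet.2 hle he'
      rw [edgeSet_deleteEdges] at this
      exact this.2 (Set.mem_biUnion (Finset.mem_coe.2 (Finset.mem_range.2 hi)) he)
    refine ⟨Function.update f N g, ?_, ?_⟩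
    · intro i hi
      by_cases h : i = N
      · subst h
        rw [Function.update_self]
        exact ⟨hg, hle.trans (deleteEdges_le _)⟩
      · rw [Function.update_of_ne h]
        exact hf i (by lia)
    · intro i hi j hj hij
      by_cases h : i = N
      · subst h
        rw [Function.update_self, Function.update_of_ne hij.symm]
        exact (hnew j (by lia)).symm
      · rw [Function.update_of_ne h]
        by_cases h' : j = N
        · subst h'
          rw [Function.update_self]
          exact hnew i (by lia)
        · rw [Function.update_of_ne h']
          exact hdisj i (by lia) j (by lia) hij

/-- The `2 ^ d - 1` nonempty subsets of `{1, …, d}` index the forests; the empty set would give a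
color without edges. -/
theorem le_tau_of_crossPairs [Finite V] [Nonempty V] [DecidableEq V] (G : SimpleGraph V)
    {k d M N : ℕ} (hG : ∀ A B : Finset V, A.card = k → B.card = k → Disjoint A B →
      M ≤ (G.edgeSet ∩ crossPairs A B).ncard)
    (hd : (d + 1) ^ 2 + 2 * k ≤ Nat.card V) (hN : N * (d + 1) ^ 2 ≤ M) (hN' : N < 2 ^ d) :
    N ≤ G.tau := by
  let P := (Finset.Icc 1 d).powerset.erase ∅
  have hP : N ≤ Fintype.card P := by
    rw [Fintype.card_coe, Finset.card_erase_of_mem (by simp), Finset.card_powerset]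
    simp
    lia
  obtain ⟨φ⟩ : Nonempty (Fin N ↪ P) := by
    rw [Function.Embedding.nonempty_iff_card_le]
    simpa using hP
  let S : ℕ → Finset ℕ := fun i => if h : i < N then (φ ⟨i, h⟩ : Finset ℕ) else ∅
  have hS : ∀ i : Fin N, S i = φ i := fun i => by simp [S]
  have hS1 : ∀ i : Fin N, ∀ x ∈ S i, 1 ≤ x ∧ (x + 1) ^ 2 ≤ (d + 1) ^ 2 := by
    intro i x hx
    have h := Finset.mem_powerset.1 (Finset.mem_of_mem_erase (φ i).2) (hS i ▸ hx)
    rw [Finset.mem_Icc] at h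
    exact ⟨h.1, Nat.pow_le_pow_left (by lia) 2⟩
  obtain ⟨f, hf, hdisj⟩ := exists_disjoint_blockGraphs G hG hd S N
    (lt_of_le_of_lt hN (Nat.lt_add_of_pos_right (by positivity)))
  refine le_tau_of_pairwise_disjoint (fun i : Fin N => blockGraph (f i) ((d + 1) ^ 2) (S i))
    (fun i => (hf i i.2).2) (fun i => blockGraph_ne_bot (hf i i.2).1 (hS1 i) ?_)
    (fun i j hij => hdisj i i.2 j j.2 (Fin.val_ne_of_ne hij)) fun i j hij => ⟨fun e => hij ?_⟩
  · rw [hS, Finset.nonempty_iff_ne_empty]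
    exact Finset.ne_of_mem_erase (φ i).2
  · have := blockGraph_iso_eq (hf i i.2).1 (hf j j.2).1 (hS1 i) (hS1 j) e
    rw [hS, hS] at this
    exact φ.injective (Subtype.ext this)

/-! ### Counting small isomorphism types -/

theorem ncard_support_le [Finite V] (G : SimpleGraph V) :
    G.support.ncard ≤ 2 * G.edgeSet.ncard := by
  classical
  cases nonempty_fintype V
  have h : G.support ⊆ (G.edgeFinset.biUnion Sym2.toFinset : Finset V) := by
    intro v hv
    obtain ⟨w, hw⟩ := hv
    simp only [Finset.coe_biUnion, Set.mem_iUnion]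
    exact ⟨s(v, w), by simpa using hw, by simp⟩
  calc G.support.ncard ≤ _ := Set.ncard_le_ncard h (Finset.finite_toSet _)
    _ ≤ G.edgeFinset.card * 2 := by
      rw [Set.ncard_coe_finset]
      refine Finset.card_biUnion_le_card_mul _ _ _ fun e _ => ?_
      rw [Sym2.card_toFinset]
      split_ifs <;> simp
    _ = 2 * G.edgeSet.ncard := by rw [mul_comm, ← coe_edgeFinset, Set.ncard_coe_finset]

/-- A graph whose non-isolated vertices fit into `T` has a copy living on `T`. -/
theorem exists_iso_support_subset [Finite V] (G : SimpleGraph V) (T : Finset V)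
    (h : G.support.ncard ≤ T.card) :
    ∃ H : SimpleGraph V, Nonempty (G ≃g H) ∧ H.support ⊆ T := by
  classical
  cases nonempty_fintype V
  obtain ⟨S, hS, hc⟩ := Finset.exists_superset_card_eq (s := G.support.toFinset) (n := T.card)
    (by rwa [← Set.ncard_eq_toFinset_card']) (Finset.card_le_univ T)
  let e : {x // x ∈ S} ≃ {x // x ∈ T} := Finset.equivOfCardEq hc
  let σ : Equiv.Perm V := e.extendSubtype
  refine ⟨G.map σ.toEmbedding, ⟨Iso.map σ G⟩, ?_⟩
  rintro v ⟨w, hw⟩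
  obtain ⟨x, y, hxy, rfl, rfl⟩ := (map_adj _ _ _ _).1 hw
  exact e.extendSubtype_mem x (hS (by simpa using ⟨y, hxy⟩))

/-- There are at most `|X| ^ j` subsets of size `j`; `max 1` makes the powers monotone in `j` even
for empty `X`. -/
theorem card_filter_powerset_card_le {α : Type*} [DecidableEq α] (X : Finset α) (k : ℕ) :
    (X.powerset.filter fun s => s.card ≤ k).card ≤ (k + 1) * max 1 X.card ^ k := by
  have h : (X.powerset.filter fun s => s.card ≤ k) ⊆
      (Finset.range (k + 1)).biUnion fun j => X.powersetCard j := by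
    intro s hs
    simp only [Finset.mem_filter, Finset.mem_powerset] at hs
    simp only [Finset.mem_biUnion, Finset.mem_range, Finset.mem_powersetCard]
    exact ⟨s.card, by lia, hs.1, rfl⟩
  calc _ ≤ _ := Finset.card_le_card h
    _ ≤ (Finset.range (k + 1)).card * max 1 X.card ^ k := by
      refine Finset.card_biUnion_le_card_mul _ _ _ fun j hj => ?_
      rw [Finset.card_powersetCard]
      calc X.card.choose j ≤ X.card ^ j := Nat.choose_le_pow _ _
        _ ≤ max 1 X.card ^ j := Nat.pow_le_pow_left (le_max_right _ _) _
        _ ≤ max 1 X.card ^ k :=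
          Nat.pow_le_pow_right (lt_max_of_lt_left one_pos) (Nat.lt_succ_iff.1 (Finset.mem_range.1 hj))
    _ = _ := by simp

/-- There are few isomorphism types of graphs with at most `k` edges. -/
theorem card_le_of_pairwise_not_iso [Finite V] {ι : Type*} (s : Finset ι) (H : ι → SimpleGraph V)
    (k : ℕ) (hk : 2 * k ≤ Nat.card V) (hs : ∀ i ∈ s, (H i).edgeSet.ncard ≤ k)
    (hiso : ∀ i ∈ s, ∀ j ∈ s, i ≠ j → IsEmpty (H i ≃g H j)) :
    s.card ≤ (2 * k + 1) ^ (2 * k + 1) := by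
  classical
  cases nonempty_fintype V
  -- At most `k` edges touch at most `2 * k` vertices, so every graph has a copy on the same `T`,
  -- and non-isomorphic graphs become distinct edge sets there.
  obtain ⟨T, -, hT⟩ := Finset.exists_subset_card_eq (s := (Finset.univ : Finset V)) (n := 2 * k)
    (by simpa [Nat.card_eq_fintype_card] using hk)
  have hex : ∀ i, ∃ K : SimpleGraph V, i ∈ s → Nonempty (H i ≃g K) ∧ K.support ⊆ T := by
    intro i
    by_cases hi : i ∈ s
    · obtain ⟨K, hK⟩ := exists_iso_support_subset (H i) T
        ((ncard_support_le _).trans (by rw [hT]; have := hs i hi; lia))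
      exact ⟨K, fun _ => hK⟩
    · exact ⟨⊥, fun h => absurd h hi⟩
  choose K hK using hex
  have hmaps : ∀ i ∈ s, (K i).edgeFinset ∈ (T.sym2.powerset.filter fun s => s.card ≤ k) := by
    intro i hi
    obtain ⟨⟨f⟩, h2⟩ := hK i hi
    simp only [Finset.mem_filter, Finset.mem_powerset]
    constructor
    · intro e he
      induction e using Sym2.ind with
      | _ x y =>
        have h : (K i).Adj x y := by simpa using he
        exact Finset.mk_mem_sym2_iff.2 ⟨h2 ⟨y, h⟩, h2 ⟨x, h.symm⟩⟩
    · rw [← Set.ncard_coe_finset, coe_edgeFinset]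
      refine le_trans (le_of_eq ?_) (hs i hi)
      exact f.symm.ncard_edgeSet_eq
  have hinj : Set.InjOn (fun i => (K i).edgeFinset) s := by
    intro i hi j hj hij
    by_contra hne
    obtain ⟨⟨f⟩, -⟩ := hK i hi
    obtain ⟨⟨g⟩, -⟩ := hK j hj
    have : K i = K j := by simpa using hij
    rw [this] at f
    exact (hiso i hi j hj hne).false (f.trans g.symm)
  refine (Finset.card_le_card_of_injOn _ hmaps hinj).trans
    ((card_filter_powerset_card_le _ _).trans ?_)
  have h1 : max 1 T.sym2.card ≤ (2 * k + 1) ^ 2 := by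
    rw [Finset.card_sym2, hT, Nat.choose_two_right]
    refine max_le (Nat.one_le_pow _ _ (by lia)) ((Nat.div_le_self _ _).trans ?_)
    rw [sq]
    exact Nat.mul_le_mul_left _ (by lia)
  calc (k + 1) * max 1 T.sym2.card ^ k ≤ (2 * k + 1) * ((2 * k + 1) ^ 2) ^ k :=
        Nat.mul_le_mul (by lia) (Nat.pow_le_pow_left h1 k)
    _ = _ := by rw [← pow_mul, pow_succ, mul_comm]

/-- Colors with few edges are few by `card_le_of_pairwise_not_iso`, the others by counting edges. -/
theorem mul_tau_le [Finite V] (G : SimpleGraph V) (k : ℕ) (hk : 2 * k ≤ Nat.card V) :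
    (k + 1) * G.tau ≤ G.edgeSet.ncard + (k + 1) * (2 * k + 1) ^ (2 * k + 1) := by
  classical
  cases nonempty_fintype V
  obtain ⟨c, -, hc⟩ := (isGreatest_tau G).1
  have hcard : ∀ i, (c.labelGraph i).edgeSet.ncard =
      (Finset.univ.filter fun e : G.edgeSet => c e = i).card := by
    intro i
    rw [c.edgeSet_labelGraph, Set.ncard_image_of_injective _ Subtype.val_injective, ← Set.ncard_coe_finset]
    simp
  let s := Finset.univ.filter fun i => (c.labelGraph i).edgeSet.ncard ≤ k
  have hs : s.card ≤ (2 * k + 1) ^ (2 * k + 1) :=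
    card_le_of_pairwise_not_iso s c.labelGraph k hk (fun i hi => (Finset.mem_filter.1 hi).2)
      fun i _ j _ hij => hc hij
  have hl : (k + 1) * sᶜ.card ≤ G.edgeSet.ncard := by
    calc (k + 1) * sᶜ.card = ∑ i ∈ sᶜ, (k + 1) := by simp [mul_comm]
      _ ≤ ∑ i ∈ sᶜ, (c.labelGraph i).edgeSet.ncard := by
        refine Finset.sum_le_sum fun i hi => ?_
        simp only [s, Finset.mem_compl, Finset.mem_filter, Finset.mem_univ, true_and] at hi
        lia
      _ ≤ ∑ i, (c.labelGraph i).edgeSet.ncard :=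
        Finset.sum_le_sum_of_subset (Finset.subset_univ _)
      _ = (Finset.univ : Finset G.edgeSet).card := by
        rw [Finset.card_eq_sum_card_fiberwise (f := c) (t := Finset.univ) fun _ _ => by simp]
        refine Finset.sum_congr rfl fun i _ => ?_
        convert hcard i
      _ = G.edgeSet.ncard := by
        rw [Finset.card_univ, ← Nat.card_eq_fintype_card, Nat.card_coe_set_eq]
  have hsum : sᶜ.card + s.card = G.tau := by simp [Finset.card_compl_add_card]
  calc (k + 1) * G.tau = (k + 1) * sᶜ.card + (k + 1) * s.card := by
        rw [← mul_add, hsum]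
    _ ≤ _ := Nat.add_le_add hl (Nat.mul_le_mul_left _ hs)

end SimpleGraph

/-! ### Exponential tail bounds for the random graph -/

namespace SimpleGraph

open MeasureTheory

/-- Exponential Markov inequality for the binomial random graph. -/
theorem binomialRandom_real_le {V : Type*} [Fintype V] [DecidableEq V] (p : unitInterval)
    (S : Set (SimpleGraph V)) (a : Sym2 V → ℝ) (ha : ∀ e, 0 ≤ a e) (K : ℝ) (hK : 0 ≤ K)
    (h : ∀ G ∈ S, 1 ≤ K * ∏ᶠ e ∈ G.edgeSet, a e) :
    (binomialRandom V p).real S ≤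
      K * ∏ e ∈ (⊤ : SimpleGraph V).edgeFinset, (1 - p + p * a e) := by
  classical
  have hp : (0 : ℝ) ≤ p := p.2.1
  have hq : (0 : ℝ) ≤ 1 - p := by linarith [p.2.2]
  set U := (⊤ : SimpleGraph V).edgeFinset with hU
  have hUc : U.card = (Nat.card V).choose 2 := by
    rw [hU, card_edgeFinset_top_eq_card_choose_two, Nat.card_eq_fintype_card]
  have hsub : ∀ G : SimpleGraph V, G.edgeFinset ⊆ U := fun G => edgeFinset_mono le_top
  have hsing : ∀ G : SimpleGraph V, (binomialRandom V p).real {G} =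
      (p : ℝ) ^ G.edgeFinset.card * (1 - p : ℝ) ^ (U \ G.edgeFinset).card := by
    intro G
    rw [measureReal_def, binomialRandom_singleton, Finset.card_sdiff_of_subset (hsub G), hUc,
      ← coe_edgeFinset, Set.ncard_coe_finset]
    simp
  let s : Finset (SimpleGraph V) := S.toFinite.toFinset
  have hs : ∀ G, G ∈ s ↔ G ∈ S := fun G => Set.Finite.mem_toFinset _
  let w : SimpleGraph V → ℝ := fun G =>
    (∏ e ∈ G.edgeFinset, (p * a e : ℝ)) * ∏ _e ∈ U \ G.edgeFinset, (1 - p : ℝ)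
  have hw : ∀ G, 0 ≤ w G := fun G => mul_nonneg
    (Finset.prod_nonneg fun e _ => mul_nonneg hp (ha e)) (Finset.prod_nonneg fun _ _ => hq)
  calc (binomialRandom V p).real S ≤ ∑ G ∈ s, (binomialRandom V p).real {G} := by
        have hS : S = ⋃ G ∈ s, {G} := by
          ext G
          simp [hs]
        conv_lhs => rw [hS]
        exact measureReal_biUnion_finset_le _ _
    _ ≤ ∑ G ∈ s, K * w G := by
        refine Finset.sum_le_sum fun G hG => ?_
        have h1 := h G ((hs G).1 hG)
        rw [← coe_edgeFinset, finprod_mem_coe_finset] at h1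
        rw [hsing]
        simp only [w, Finset.prod_mul_distrib, Finset.prod_const]
        have h2 : 0 ≤ (p : ℝ) ^ G.edgeFinset.card * (1 - p : ℝ) ^ (U \ G.edgeFinset).card := by
          positivity
        nlinarith [mul_le_mul_of_nonneg_left h1 h2]
    _ ≤ ∑ G, K * w G := Finset.sum_le_sum_of_subset_of_nonneg (Finset.subset_univ _)
        fun G _ _ => mul_nonneg hK (hw G)
    _ = K * ∑ G, w G := by rw [Finset.mul_sum]
    -- Summed over all subsets of `U`, the weights factor over the pairs by `Finset.prod_add`.
    _ ≤ K * ∑ E ∈ U.powerset, (∏ e ∈ E, (p * a e : ℝ)) * ∏ _e ∈ U \ E, (1 - p : ℝ) := by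
        refine mul_le_mul_of_nonneg_left ?_ hK
        have hinj : Set.InjOn (fun G : SimpleGraph V => G.edgeFinset)
            (Finset.univ : Finset (SimpleGraph V)) := fun G _ G' _ hG => edgeFinset_inj.1 hG
        refine (Finset.sum_image (f := fun E => (∏ e ∈ E, (p * a e : ℝ)) *
          ∏ _e ∈ U \ E, (1 - p : ℝ)) hinj).symm.le.trans ?_
        refine Finset.sum_le_sum_of_subset_of_nonneg ?_ fun E _ _ => mul_nonneg
          (Finset.prod_nonneg fun e _ => mul_nonneg hp (ha e)) (Finset.prod_nonneg fun _ _ => hq)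
        intro E hE
        obtain ⟨G, -, rfl⟩ := Finset.mem_image.1 hE
        exact Finset.mem_powerset.2 (hsub G)
    _ = _ := by
        rw [← Finset.prod_add]
        exact congrArg _ (Finset.prod_congr rfl fun e _ => by ring)

/-- Weight `e` per edge: each of the at most `n ^ 2 / 2` pairs contributes a factor at most `exp (2
* p)`, since `e - 1 < 2`. -/
theorem binomialRandom_real_lt_ncard_edgeSet_le {V : Type*} [Fintype V] (p : unitInterval) :
    (binomialRandom V p).real {G | 2 * p * (Fintype.card V : ℝ) ^ 2 < G.edgeSet.ncard} ≤
      Real.exp (-(p * (Fintype.card V : ℝ) ^ 2)) := by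
  classical
  have hp : (0 : ℝ) ≤ p := p.2.1
  set n := Fintype.card V
  refine (binomialRandom_real_le p _ (fun _ => Real.exp 1) (fun _ => (Real.exp_pos _).le)
    (Real.exp (-(2 * p * (n : ℝ) ^ 2))) (Real.exp_pos _).le fun G hG => ?_).trans ?_
  · rw [Set.mem_ofPred_eq, ← coe_edgeFinset, Set.ncard_coe_finset] at hG
    rw [← coe_edgeFinset, finprod_mem_coe_finset, Finset.prod_const, ← Real.exp_nat_mul,
      ← Real.exp_add, Real.one_le_exp_iff]
    linarith
  · have h1 : (1 - p + p * Real.exp 1 : ℝ) ≤ Real.exp (2 * p) := by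
      have := Real.add_one_le_exp (2 * p : ℝ)
      nlinarith [Real.exp_one_lt_d9]
    have h0 : (0 : ℝ) ≤ 1 - p + p * Real.exp 1 := by
      nlinarith [Real.exp_pos 1, p.2.2]
    have h2 : ((n.choose 2 : ℕ) : ℝ) ≤ (n : ℝ) ^ 2 / 2 := by
      rw [Nat.cast_choose_two]
      nlinarith [(Nat.cast_nonneg n : (0 : ℝ) ≤ n)]
    rw [Finset.prod_const, card_edgeFinset_top_eq_card_choose_two]
    calc _ ≤ Real.exp (-(2 * p * (n : ℝ) ^ 2)) * Real.exp (2 * p) ^ n.choose 2 :=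
          mul_le_mul_of_nonneg_left (pow_le_pow_left₀ h0 h1 _) (Real.exp_pos _).le
      _ = Real.exp (-(2 * p * (n : ℝ) ^ 2) + n.choose 2 * (2 * p)) := by
          rw [← Real.exp_nat_mul, ← Real.exp_add]
      _ ≤ _ := Real.exp_le_exp.2 (by nlinarith)

theorem card_crossPairs {V : Type*} [DecidableEq V] {A B : Finset V} (h : Disjoint A B) :
    (crossPairs A B).card = A.card * B.card := by
  rw [crossPairs, Finset.card_image_of_injOn, Finset.card_product]
  rintro ⟨a, b⟩ hab ⟨c, d⟩ hcd he
  simp only [Finset.coe_product, Set.mem_prod, Finset.mem_coe] at hab hcd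
  rcases Sym2.eq_iff.1 he with ⟨h1, h2⟩ | ⟨h1, h2⟩
  · exact Prod.ext h1 h2
  · exact absurd hcd.2 (Finset.disjoint_left.1 h ((show a = d from h1) ▸ hab.1))

theorem crossPairs_subset_edgeFinset_top {V : Type*} [Fintype V] [DecidableEq V] {A B : Finset V}
    (h : Disjoint A B) : crossPairs A B ⊆ (⊤ : SimpleGraph V).edgeFinset := by
  intro e he
  obtain ⟨⟨a, b⟩, hab, rfl⟩ := Finset.mem_image.1 he
  rw [Finset.mem_product] at hab
  simpa using fun hab' : a = b => Finset.disjoint_left.1 h hab.1 (hab' ▸ hab.2)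

/-- Weight `1 / e` per crossing edge: the `k ^ 2` pairs contribute at most `exp (-(p / 2))` each,
against a prefactor `exp (p * k ^ 2 / 4)`. -/
theorem binomialRandom_real_crossPairs_lt_le {V : Type*} [Fintype V] [DecidableEq V]
    (p : unitInterval) {A B : Finset V} {k : ℕ} (hA : A.card = k) (hB : B.card = k)
    (h : Disjoint A B) :
    (binomialRandom V p).real
      {G | ((G.edgeSet ∩ crossPairs A B).ncard : ℝ) < p * (k : ℝ) ^ 2 / 4} ≤
        Real.exp (-(p * (k : ℝ) ^ 2 / 4)) := by
  classical
  have hp : (0 : ℝ) ≤ p := p.2.1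
  refine (binomialRandom_real_le p _ (fun e => if e ∈ crossPairs A B then Real.exp (-1) else 1)
    (fun e => by split_ifs <;> positivity)
    (Real.exp (p * (k : ℝ) ^ 2 / 4)) (Real.exp_pos _).le fun G hG => ?_).trans ?_
  · have hc : (G.edgeSet ∩ crossPairs A B).ncard =
        (G.edgeFinset.filter (· ∈ crossPairs A B)).card := by
      rw [← Set.ncard_coe_finset]
      congr 1
      ext e
      simp
    rw [Set.mem_ofPred_eq, hc] at hG
    rw [← coe_edgeFinset, finprod_mem_coe_finset, ← Finset.prod_filter, Finset.prod_const,
      ← Real.exp_nat_mul, ← Real.exp_add, Real.one_le_exp_iff]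
    linarith
  · have he : Real.exp (-1) ≤ 1 / 2 := by
      rw [Real.exp_neg, ← one_div]
      exact one_div_le_one_div_of_le two_pos (by linarith [Real.add_one_le_exp (1 : ℝ)])
    have h1 : (1 - p + p * Real.exp (-1) : ℝ) ≤ Real.exp (-(p / 2)) := by
      have := Real.add_one_le_exp (-(p / 2) : ℝ)
      nlinarith
    have h0 : (0 : ℝ) ≤ 1 - p + p * Real.exp (-1) := by
      nlinarith [Real.exp_pos (-1), p.2.2]
    have hprod : ∏ e ∈ (⊤ : SimpleGraph V).edgeFinset,
        (1 - p + p * (if e ∈ crossPairs A B then Real.exp (-1) else 1) : ℝ) =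
        (1 - p + p * Real.exp (-1) : ℝ) ^ (k * k) := by
      rw [← Finset.prod_subset (crossPairs_subset_edgeFinset_top h) fun e _ he => by simp [he],
        Finset.prod_congr rfl fun e he => by rw [if_pos he], Finset.prod_const,
        card_crossPairs h, hA, hB]
    rw [hprod]
    calc _ ≤ Real.exp (p * (k : ℝ) ^ 2 / 4) * Real.exp (-(p / 2)) ^ (k * k) :=
          mul_le_mul_of_nonneg_left (pow_le_pow_left₀ h0 h1 _) (Real.exp_pos _).le
      _ = Real.exp (p * (k : ℝ) ^ 2 / 4 + (k * k : ℕ) * (-(p / 2))) := by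
          rw [← Real.exp_nat_mul, ← Real.exp_add]
      _ = _ := by
          congr 1
          push_cast
          ring

/-- Few edges between some pair of disjoint `k`-sets: union bound over all pairs. -/
theorem binomialRandom_real_exists_crossPairs_lt_le {V : Type*} [Fintype V] [DecidableEq V]
    (p : unitInterval) (k : ℕ) :
    (binomialRandom V p).real {G | ∃ A B : Finset V, A.card = k ∧ B.card = k ∧ Disjoint A B ∧
      ((G.edgeSet ∩ crossPairs A B).ncard : ℝ) < p * (k : ℝ) ^ 2 / 4} ≤
        4 ^ Fintype.card V * Real.exp (-(p * (k : ℝ) ^ 2 / 4)) := by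
  classical
  let s : Finset (Finset V × Finset V) :=
    Finset.univ.filter fun x => x.1.card = k ∧ x.2.card = k ∧ Disjoint x.1 x.2
  have hs : {G : SimpleGraph V | ∃ A B : Finset V, A.card = k ∧ B.card = k ∧ Disjoint A B ∧
      ((G.edgeSet ∩ crossPairs A B).ncard : ℝ) < p * (k : ℝ) ^ 2 / 4} =
      ⋃ x ∈ s, {G : SimpleGraph V | ((G.edgeSet ∩ crossPairs x.1 x.2).ncard : ℝ) < p * (k : ℝ) ^ 2 / 4} := by
    ext G
    simp [s, and_assoc]
  have hcard : (s.card : ℝ) ≤ 4 ^ Fintype.card V := by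
    have : s.card ≤ 4 ^ Fintype.card V := by
      refine (Finset.card_le_univ s).trans (le_of_eq ?_)
      rw [Fintype.card_prod, Fintype.card_finset, ← mul_pow]
      norm_num
    exact_mod_cast this
  rw [hs]
  refine (measureReal_biUnion_finset_le _ _).trans ?_
  refine (Finset.sum_le_card_nsmul _ _ (Real.exp (-(p * (k : ℝ) ^ 2 / 4))) fun x hx => ?_).trans ?_
  · obtain ⟨h1, h2, h3⟩ := (Finset.mem_filter.1 hx).2
    exact binomialRandom_real_crossPairs_lt_le p h1 h2 h3
  · rw [nsmul_eq_mul]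
    exact mul_le_mul_of_nonneg_right hcard (Real.exp_pos _).le

/-! ### Asymptotic estimates for both bounds -/

open Filter Real

theorem eventually_tau_le : ∀ᶠ n : ℕ in atTop, ∀ (p : ℝ) (G : SimpleGraph (Fin n)),
    (n : ℝ) ≤ p * (n : ℝ) ^ 2 → (G.edgeSet.ncard : ℝ) ≤ 2 * p * (n : ℝ) ^ 2 →
      (G.tau : ℝ) ≤ 13 * (p * (n : ℝ) ^ 2 * log (log n) / log n) := by
  have hlog : Tendsto (fun n : ℕ => log (n : ℝ)) atTop atTop :=
    tendsto_log_atTop.comp tendsto_natCast_atTop_atTop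
  have h1 : ∀ᶠ n : ℕ in atTop, 1 ≤ log (log (n : ℝ)) :=
    (tendsto_log_atTop.comp hlog).eventually_ge_atTop 1
  have h2 : ∀ᶠ n : ℕ in atTop, 6 * log (log (n : ℝ)) ≤ log n := by
    have := hlog.eventually (isLittleO_log_id_atTop.bound (show (0 : ℝ) < 1 / 6 by norm_num))
    filter_upwards [this, h1, hlog.eventually_ge_atTop 0] with n hn hy hx
    rw [id, norm_of_nonneg hx, norm_of_nonneg (by linarith)] at hn
    linarith
  have h3 : ∀ᶠ n : ℕ in atTop, log (n : ℝ) ^ 2 ≤ n := by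
    have := tendsto_natCast_atTop_atTop.eventually
      ((isLittleO_pow_log_id_atTop (n := 2)).bound (show (0 : ℝ) < 1 by norm_num))
    filter_upwards [this] with n hn
    simpa using hn
  filter_upwards [h1, h2, h3, eventually_gt_atTop 0] with n hy hxy hxn hn0 p G hp hG
  set x := log (n : ℝ) with hx
  set y := log x with hy'
  have hx6 : 6 ≤ x := by linarith
  have hn : (0 : ℝ) < n := by exact_mod_cast hn0
  -- As `2 * k + 1 ≤ 3 * k`, the factor `6` gives `(2 * k + 1) * y ≤ x / 2`, hence at most `√n`
  -- small types.
  set k := ⌊x / (6 * y)⌋₊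
  have hk1 : 1 ≤ k := Nat.le_floor (by
    rw [Nat.cast_one, le_div_iff₀ (by linarith)]
    linarith)
  have hk2 : (k : ℝ) * (6 * y) ≤ x :=
    (le_div_iff₀ (by linarith)).1 (Nat.floor_le (by positivity))
  have hk3 : x < (k + 1) * (6 * y) := (div_lt_iff₀ (by linarith)).1 (Nat.lt_floor_add_one _)
  have hk1' : (1 : ℝ) ≤ k := by exact_mod_cast hk1
  have hky : (2 * k + 1 : ℝ) * y ≤ x / 2 := by nlinarith
  have hkx : (2 * k + 1 : ℝ) ≤ x := by nlinarith
  have hkn : 2 * k ≤ Nat.card (Fin n) := by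
    rw [Nat.card_eq_fintype_card, Fintype.card_fin]
    have : (2 * k : ℝ) ≤ n := by nlinarith
    exact_mod_cast this
  have hcount : ((2 * k + 1 : ℝ)) ^ (2 * k + 1) ≤ √n := by
    calc ((2 * k + 1 : ℝ)) ^ (2 * k + 1) ≤ x ^ (2 * k + 1) :=
          pow_le_pow_left₀ (by positivity) hkx _
      _ = exp ((2 * k + 1 : ℕ) * y) := by rw [exp_nat_mul, hy', exp_log (by linarith)]
      _ ≤ exp (x / 2) := exp_le_exp.2 (by push_cast; exact hky)
      _ = √n := by rw [exp_half, hx, exp_log hn]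
  have hmain : ((k : ℝ) + 1) * G.tau ≤
      G.edgeSet.ncard + ((k : ℝ) + 1) * (2 * k + 1) ^ (2 * k + 1) := by
    exact_mod_cast mul_tau_le G k hkn
  have hsqrt : √n * x ≤ n := by
    have hle : x ≤ √n := le_sqrt_of_sq_le hxn
    nlinarith [mul_self_sqrt hn.le, sqrt_nonneg (n : ℝ)]
  -- `12 = 2 * 6`, from `2 * p * n ^ 2` edges and `k + 1 > x / (6 * y)`. The term `√n * x ≤ n` later
  -- raises the constant to `13`.
  have htau : (G.tau : ℝ) * x ≤ 12 * (p * n ^ 2 * y) + √n * x := by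
    have hT : ((k : ℝ) + 1) * ((G.tau : ℝ) - √n) ≤ 2 * p * n ^ 2 := by nlinarith
    have hq : 0 ≤ p * (n : ℝ) ^ 2 := hn.le.trans hp
    rcases le_total (G.tau : ℝ) √n with h | h
    · nlinarith [mul_nonneg hq (by linarith : 0 ≤ y)]
    · have h4 : ((G.tau : ℝ) - √n) * x ≤ ((G.tau : ℝ) - √n) * ((k + 1) * (6 * y)) :=
        mul_le_mul_of_nonneg_left hk3.le (by linarith)
      have h5 := mul_le_mul_of_nonneg_right hT (by linarith : 0 ≤ 6 * y)
      linarith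
  rw [← mul_div_assoc, le_div_iff₀ (by linarith)]
  have : p * (n : ℝ) ^ 2 ≤ p * (n : ℝ) ^ 2 * y := le_mul_of_one_le_right (hn.le.trans hp) hy
  linarith

theorem eventually_le_tau : ∀ᶠ n : ℕ in atTop, ∀ (p : unitInterval) (G : SimpleGraph (Fin n)),
    192 * (n : ℝ) ≤ p * (n : ℝ) ^ 2 →
      (∀ A B : Finset (Fin n), A.card = n / 4 + 1 → B.card = n / 4 + 1 → Disjoint A B →
        (p : ℝ) * ((n / 4 + 1 : ℕ) : ℝ) ^ 2 / 4 ≤ (G.edgeSet ∩ crossPairs A B).ncard) →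
      1 / 4608 * ((p : ℝ) * (n : ℝ) ^ 2 / log n ^ 2) ≤ (G.tau : ℝ) := by
  have hlog : Tendsto (fun n : ℕ => log (n : ℝ)) atTop atTop :=
    tendsto_log_atTop.comp tendsto_natCast_atTop_atTop
  -- `288 = 8 * 36`: since `d + 1 ≤ 6 * log n`, the path needs at most `n / 8` vertices.
  have h3 : ∀ᶠ n : ℕ in atTop, 288 * log (n : ℝ) ^ 2 ≤ n := by
    have := tendsto_natCast_atTop_atTop.eventually
      ((isLittleO_pow_log_id_atTop (n := 2)).bound (show (0 : ℝ) < 1 / 288 by norm_num))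
    filter_upwards [this] with n hn
    simp only [norm_pow, norm_eq_abs, sq_abs, id, Nat.abs_cast] at hn
    linarith
  filter_upwards [h3, hlog.eventually_ge_atTop 1, eventually_ge_atTop 16]
    with n hxn hx1 hn16 p G hp hG
  set x := log (n : ℝ) with hx
  have hn : (16 : ℝ) ≤ n := by exact_mod_cast hn16
  have hp0 : (0 : ℝ) ≤ p := p.2.1
  have hp1 : (p : ℝ) ≤ 1 := p.2.2
  have : Nonempty (Fin n) := ⟨⟨0, by lia⟩⟩
  set k := n / 4 + 1 with hk
  -- This makes `2 ^ d > n ^ 2 ≥ N`, so there are enough index sets.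
  set d := 2 * Nat.log 2 n + 2 with hd
  set M := ⌈(p : ℝ) * (k : ℝ) ^ 2 / 4⌉₊ with hM
  set N := M / (d + 1) ^ 2 with hN
  have hk4 : (n : ℝ) ≤ 4 * k := by
    have : n ≤ 4 * k := by lia
    exact_mod_cast this
  have hM1 : (p : ℝ) * n ^ 2 / 64 ≤ M := by
    refine le_trans ?_ (Nat.le_ceil _)
    have : (n : ℝ) ^ 2 ≤ 16 * k ^ 2 := by nlinarith
    nlinarith
  have hM2 : M ≤ k ^ 2 := Nat.ceil_le.2 (by
    push_cast
    nlinarith [sq_nonneg (k : ℝ)])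
  have hdx : ((d + 1 : ℕ) : ℝ) ≤ 6 * x := by
    have h1 : (Nat.log 2 n : ℝ) * log 2 ≤ x := by
      rw [← log_pow]
      refine log_le_log (by positivity) ?_
      exact_mod_cast Nat.pow_log_le_self 2 (by lia)
    rw [hd]
    push_cast
    nlinarith [log_two_gt_d9, (Nat.cast_nonneg (Nat.log 2 n) : (0 : ℝ) ≤ _)]
  have hL : (((d + 1) ^ 2 : ℕ) : ℝ) ≤ 36 * x ^ 2 := by
    rw [Nat.cast_pow]
    nlinarith [(Nat.cast_nonneg (d + 1) : (0 : ℝ) ≤ _)]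
  have hL0 : (0 : ℝ) < (((d + 1) ^ 2 : ℕ) : ℝ) := by positivity
  have hLn : 8 * (d + 1) ^ 2 ≤ n := by
    have : (8 : ℝ) * ((d + 1) ^ 2 : ℕ) ≤ n := by linarith
    exact_mod_cast this
  have hNtau : N ≤ G.tau := by
    refine le_tau_of_crossPairs G (k := k) (d := d) (M := M)
      (fun A B hA hB hAB => Nat.ceil_le.2 (hG A B hA hB hAB)) ?_ (Nat.div_mul_le_self _ _) ?_
    · rw [Nat.card_eq_fintype_card, Fintype.card_fin]
      lia
    · calc N ≤ M := Nat.div_le_self _ _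
        _ ≤ k ^ 2 := hM2
        _ ≤ n ^ 2 := Nat.pow_le_pow_left (by lia) 2
        _ < (2 ^ (Nat.log 2 n + 1)) ^ 2 :=
          Nat.pow_lt_pow_left (Nat.lt_pow_succ_log_self (by lia) n) (by lia)
        _ = 2 ^ d := by rw [← pow_mul, hd]; congr 1; lia
  -- Rounding in `N` loses at most a factor `2`, because `M ≥ n ≥ (d + 1) ^ 2`.
  have hNM : (M : ℝ) ≤ 2 * N * ((d + 1) ^ 2 : ℕ) := by
    have h1 : M < (N + 1) * (d + 1) ^ 2 := by
      rw [mul_comm]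
      exact Nat.lt_mul_div_succ _ (by positivity)
    have h2 : 1 ≤ N := by
      rw [hN, Nat.one_le_div_iff (by positivity)]
      have : (n : ℝ) ≤ M := by linarith
      have : n ≤ M := by exact_mod_cast this
      lia
    have h3 : M ≤ 2 * N * (d + 1) ^ 2 :=
      h1.le.trans (Nat.mul_le_mul_right _ (by lia))
    exact_mod_cast h3
  -- `4608 = 64 * 2 * 36`, from `hM1`, `hNM` and `hL`.
  have hfin : (p : ℝ) * n ^ 2 / x ^ 2 ≤ 4608 * N := by
    rw [div_le_iff₀ (by positivity)]
    have : 2 * (N : ℝ) * ((d + 1) ^ 2 : ℕ) ≤ 2 * N * (36 * x ^ 2) :=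
      mul_le_mul_of_nonneg_left hL (by positivity)
    linarith
  have : (N : ℝ) ≤ G.tau := by exact_mod_cast hNtau
  linarith

end SimpleGraph

/-! ### Combining the two bounds -/

open Filter Real MeasureTheory SimpleGraph in
theorem theorem2 :
    ∃ C : ℝ, 0 < C ∧ ∃ c₁ : ℝ, 0 < c₁ ∧ ∃ c₂ : ℝ, 0 < c₂ ∧
      ∀ p : ℕ → unitInterval,
        (∀ᶠ n : ℕ in Filter.atTop, C / (n : ℝ) ≤ (p n : ℝ)) →
        Filter.Tendsto
          (fun n : ℕ => SimpleGraph.binomialRandom (Fin n) (p n)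
            {G : SimpleGraph (Fin n) |
              c₁ * ((p n : ℝ) * (n : ℝ) ^ 2 / Real.log n ^ 2) ≤ (G.tau : ℝ) ∧
              (G.tau : ℝ) ≤
                c₂ * ((p n : ℝ) * (n : ℝ) ^ 2 * Real.log (Real.log n) / Real.log n)})
          Filter.atTop (nhds 1) := by
  -- `192 = 3 * 64`: a given pair of sets fails with probability at most `exp (-(p * n ^ 2 / 64)) ≤
  -- exp (-3 * n)`, which beats the `4 ^ n ≤ exp (2 * n)` pairs.
  refine ⟨192, by norm_num, 1 / 4608, by norm_num, 13, by norm_num, fun p hp => ?_⟩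
  refine (ENNReal.tendsto_toReal_iff (fun n => measure_ne_top _ _) ENNReal.one_ne_top).1 ?_
  rw [ENNReal.toReal_one]
  have hlim : Tendsto (fun n : ℕ => 1 - 2 * exp (-(n : ℝ))) atTop (nhds 1) := by
    have := (tendsto_exp_neg_atTop_nhds_zero.comp tendsto_natCast_atTop_atTop).const_mul (2 : ℝ)
    simpa using this.const_sub 1
  refine tendsto_of_tendsto_of_tendsto_of_le_of_le' hlim tendsto_const_nhds ?_
    (Eventually.of_forall fun n => measureReal_le_one)
  filter_upwards [hp, eventually_tau_le, eventually_le_tau, eventually_gt_atTop 0]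
    with n hpn hupper hlower hn0
  have hn : (0 : ℝ) < n := by exact_mod_cast hn0
  have hpn2 : 192 * (n : ℝ) ≤ p n * (n : ℝ) ^ 2 := by
    rw [div_le_iff₀ hn] at hpn
    nlinarith
  set good := {G : SimpleGraph (Fin n) |
    1 / 4608 * ((p n : ℝ) * (n : ℝ) ^ 2 / log n ^ 2) ≤ (G.tau : ℝ) ∧
    (G.tau : ℝ) ≤ 13 * ((p n : ℝ) * (n : ℝ) ^ 2 * log (log n) / log n)}
  set dense := {G : SimpleGraph (Fin n) | 2 * p n * (Fintype.card (Fin n) : ℝ) ^ 2 <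
    G.edgeSet.ncard} with hdense
  set sparse := {G : SimpleGraph (Fin n) | ∃ A B : Finset (Fin n), A.card = n / 4 + 1 ∧
    B.card = n / 4 + 1 ∧ Disjoint A B ∧ ((G.edgeSet ∩ crossPairs A B).ncard : ℝ) <
      p n * ((n / 4 + 1 : ℕ) : ℝ) ^ 2 / 4} with hsparse
  have hcover : (Set.univ : Set (SimpleGraph (Fin n))) ⊆ good ∪ (dense ∪ sparse) := by
    intro G _
    by_cases hd : G ∈ dense
    · exact Or.inr (Or.inl hd)
    by_cases hs : G ∈ sparse
    · exact Or.inr (Or.inr hs)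
    rw [hdense, Set.mem_ofPred_eq, not_lt, Fintype.card_fin] at hd
    rw [hsparse, Set.mem_ofPred_eq] at hs
    push Not at hs
    exact Or.inl ⟨hlower (p n) G hpn2 hs, hupper (p n) G (by linarith) hd⟩
  have hdense_le : (binomialRandom (Fin n) (p n)).real dense ≤ exp (-(n : ℝ)) := by
    refine (binomialRandom_real_lt_ncard_edgeSet_le (p n)).trans (exp_le_exp.2 ?_)
    rw [Fintype.card_fin]
    linarith
  have hsparse_le : (binomialRandom (Fin n) (p n)).real sparse ≤ exp (-(n : ℝ)) := by
    refine (binomialRandom_real_exists_crossPairs_lt_le (p n) (n / 4 + 1)).trans ?_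
    have h4 : (4 : ℝ) ≤ exp 2 := by
      rw [show (2 : ℝ) = 1 + 1 by norm_num, exp_add]
      nlinarith [add_one_le_exp (1 : ℝ)]
    have hk : (n : ℝ) ≤ 4 * ((n / 4 + 1 : ℕ) : ℝ) := by
      have : n ≤ 4 * (n / 4 + 1) := by lia
      exact_mod_cast this
    have hk2 : (p n : ℝ) * (n : ℝ) ^ 2 ≤ p n * (16 * ((n / 4 + 1 : ℕ) : ℝ) ^ 2) :=
      mul_le_mul_of_nonneg_left (by nlinarith) (p n).2.1
    rw [Fintype.card_fin]
    calc _ ≤ exp 2 ^ n * exp (-((p n : ℝ) * ((n / 4 + 1 : ℕ) : ℝ) ^ 2 / 4)) :=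
          mul_le_mul_of_nonneg_right (pow_le_pow_left₀ (by norm_num) h4 n) (exp_pos _).le
      _ = exp (n * 2 + -((p n : ℝ) * ((n / 4 + 1 : ℕ) : ℝ) ^ 2 / 4)) := by
          rw [← exp_nat_mul, ← exp_add]
      _ ≤ _ := exp_le_exp.2 (by linarith)
  have h1 : (1 : ℝ) ≤ (binomialRandom (Fin n) (p n)).real good +
      ((binomialRandom (Fin n) (p n)).real dense +
        (binomialRandom (Fin n) (p n)).real sparse) := by
    calc (1 : ℝ) = (binomialRandom (Fin n) (p n)).real Set.univ := by simp
      _ ≤ _ := measureReal_mono hcover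
      _ ≤ _ := (measureReal_union_le _ _).trans (by gcongr; exact measureReal_union_le _ _)
  change _ ≤ (binomialRandom (Fin n) (p n)).real good
  linarith
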